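/- Let $m\ge 1$ and let $(N,\beta)$ be a symplectic manifold of dimension $2m$: $N$ is a smooth ($C^\infty$) manifold and $\beta$ is a smooth closed 2-form on $N$ that is nondegenerate, i.e. for every $z\in N$ and $a\in T_zN$, $\beta_z(a,\cdot)=0$ implies $a=0$. Let $H:N\to\mathbb{R}$ be a function of class $C^1$ and let $w$ be its Hamiltonian vector field, i.e. the unique vector field on $N$ with $\beta(w,\cdot)=-dH$. Let $h\in\mathbb{R}$ be such that $dH(z)\neq 0$ at every point $z$ of the energy level $E_h=\{z\in N : H(z)=h\}$. Let $Y$ be a (possibly only immersed) $(2m-2)$-dimensional submanifold of $N$ contained in $E_h$, i.e. $Y$ is a smooth manifold of dimension $2m-2$ together with a smooth immersion $\iota:Y\to N$ (the inclusion, if $Y\subset N$) with $\iota(Y)\subset E_h$. Suppose that $w$ is nowhere tangent to $Y$: $w(\iota(y))\notin d\iota_y(T_yY)$ for all $y\in Y$. Then the restriction $\beta|_Y=\iota^*\beta$ is nondegenerate, and $(Y,\beta|_Y)$ is a symplectic manifold, i.e. $\beta|_Y$ is a smooth, closed and nondegenerate 2-form on $Y$. -/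

import Mathlib

open scoped Manifold ContDiff

noncomputable section

/-- A differential form of degree `k` on an `n`-dimensional manifold (no regularity imposed). -/
abbrev DiffForm (n k : ℕ) (M : Type*) [TopologicalSpace M]
    [ChartedSpace (EuclideanSpace ℝ (Fin n)) M] : Type _ :=
  (x : M) → TangentSpace (𝓡 n) x [⋀^Fin k]→L[ℝ] ℝ

/-- The pullback of the form `θ` along the map `f`. For the inclusion `f` of a submanifold, this
is the restriction of `θ` to the submanifold. -/
def DiffForm.pullback {n n' k : ℕ} {M N : Type*}
    [TopologicalSpace M] [ChartedSpace (EuclideanSpace ℝ (Fin n)) M]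
    [TopologicalSpace N] [ChartedSpace (EuclideanSpace ℝ (Fin n')) N]
    (f : M → N) (θ : DiffForm n' k N) : DiffForm n k M :=
  fun x => (θ (f x)).compContinuousLinearMap (mfderiv (𝓡 n) (𝓡 n') f x)

/-- The expression of a form in a chart `e`, meaningful on the open set `e.target`. -/
def DiffForm.inChart {n k : ℕ} {M : Type*}
    [TopologicalSpace M] [ChartedSpace (EuclideanSpace ℝ (Fin n)) M]
    (θ : DiffForm n k M) (e : OpenPartialHomeomorph M (EuclideanSpace ℝ (Fin n))) :
    EuclideanSpace ℝ (Fin n) → EuclideanSpace ℝ (Fin n) [⋀^Fin k]→L[ℝ] ℝ :=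
  θ.pullback (n := n) e.symm

/-- A form is smooth if its expression in every smooth chart is smooth. -/
def DiffForm.IsSmooth {n k : ℕ} {M : Type*}
    [TopologicalSpace M] [ChartedSpace (EuclideanSpace ℝ (Fin n)) M]
    (θ : DiffForm n k M) : Prop :=
  ∀ e ∈ IsManifold.maximalAtlas (𝓡 n) ∞ M, ContDiffOn ℝ ∞ (θ.inChart e) e.target

/-- A form is closed if its exterior derivative vanishes in every smooth chart. -/
def DiffForm.IsClosed {n k : ℕ} {M : Type*}
    [TopologicalSpace M] [ChartedSpace (EuclideanSpace ℝ (Fin n)) M]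
    (θ : DiffForm n k M) : Prop :=
  ∀ e ∈ IsManifold.maximalAtlas (𝓡 n) ∞ M, ∀ u ∈ e.target, extDeriv (θ.inChart e) u = 0

/-- A 2-form `β` is nondegenerate if `i_a β = 0` implies `a = 0`. -/
def DiffForm.IsNondegenerate {n : ℕ} {M : Type*}
    [TopologicalSpace M] [ChartedSpace (EuclideanSpace ℝ (Fin n)) M]
    (β : DiffForm n 2 M) : Prop :=
  ∀ (x : M) (a : TangentSpace (𝓡 n) x),
    (∀ v : TangentSpace (𝓡 n) x, β x ![a, v] = 0) → a = 0

/-- `(M, β)` is a symplectic manifold: `β` is a smooth closed nondegenerate 2-form on `M`. -/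
structure IsSymplectic {n : ℕ} {M : Type*}
    [TopologicalSpace M] [ChartedSpace (EuclideanSpace ℝ (Fin n)) M]
    (β : DiffForm n 2 M) : Prop where
  smooth : β.IsSmooth
  closed : β.IsClosed
  nondegenerate : β.IsNondegenerate

/-- A nondegenerate form identifies tangent vectors with covectors. -/
theorem DiffForm.IsNondegenerate.existsUnique {n : ℕ} {M : Type*}
    [TopologicalSpace M] [ChartedSpace (EuclideanSpace ℝ (Fin n)) M]
    {β : DiffForm n 2 M} (hβ : β.IsNondegenerate) (x : M)
    (ξ : TangentSpace (𝓡 n) x →L[ℝ] ℝ) :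
    ∃! a : TangentSpace (𝓡 n) x, ∀ v : TangentSpace (𝓡 n) x, β x ![a, v] = ξ v := by
  let E := EuclideanSpace ℝ (Fin n)
  let b : E [⋀^Fin 2]→L[ℝ] ℝ := β x
  have hb : ∀ a : E, (∀ v : E, b ![a, v] = 0) → a = 0 := hβ x
  have hu : ∀ a v w : E, Function.update ![a, v] 1 w = ![a, w] := fun a v w => by
    ext i : 1
    fin_cases i <;> simp
  let F : E →ₗ[ℝ] Module.Dual ℝ E := LinearMap.mk₂ ℝ (fun a v => b ![a, v])
    (fun a a' v => by simpa using b.toMultilinearMap.cons_add ![v] a a')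
    (fun c a v => by simpa using b.toMultilinearMap.cons_smul ![v] c a)
    (fun a v v' => by
      have := b.map_update_add ![a, v] 1 v v'
      rwa [hu, hu, hu] at this)
    (fun c a v => by
      have := b.map_update_smul ![a, v] 1 c v
      rwa [hu, hu] at this)
  have hinj : Function.Injective F :=
    (injective_iff_map_eq_zero F).2 fun a ha => hb a fun v => LinearMap.congr_fun ha v
  have hsurj : Function.Surjective F :=
    (LinearMap.injective_iff_surjective_of_finrank_eq_finrank
      (Subspace.dual_finrank_eq (K := ℝ) (V := E)).symm).1 hinj
  obtain ⟨a, ha⟩ := hsurj (ξ : E →L[ℝ] ℝ).toLinearMap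
  exact ⟨a, fun v => LinearMap.congr_fun ha v, fun a' ha' =>
    hinj (LinearMap.ext fun v => (ha' v).trans (LinearMap.congr_fun ha v).symm)⟩

/-- The Hamiltonian vector field `w` of `H`, determined by `i_w β = -dH`. -/
def hamiltonianVectorField {n : ℕ} {M : Type*}
    [TopologicalSpace M] [ChartedSpace (EuclideanSpace ℝ (Fin n)) M]
    {β : DiffForm n 2 M} (hβ : IsSymplectic β) (H : M → ℝ) (x : M) : TangentSpace (𝓡 n) x :=
  (hβ.nondegenerate.existsUnique x (-(mfderiv (𝓡 n) 𝓘(ℝ, ℝ) H x))).choose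

/-- The energy level `E_h = {H = h}`. -/
def energyLevel {M : Type*} (H : M → ℝ) (h : ℝ) : Set M := {x | H x = h}

end

/-! Smoothness and closedness pass to any smooth pullback, since in charts the exterior derivative
commutes with pullback (`DiffForm.inChart_pullback`). Nondegeneracy is linear algebra at a point
(`ContinuousAlternatingMap.eq_zero_of_orthogonal_range`). Let `T` be the image of `dι`, of
codimension 2. As `H` is constant on `Y`, `β(w, ·) = -dH` vanishes on `T`. If `u ∈ T` is
`β`-orthogonal to `T`, then by skew-symmetry both `β(w, ·)` and `β(u, ·)` vanish on the hyperplane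
`T ⊕ ℝw`. Its annihilator is a line, so `u = c • w`; since `w ∉ T`, `c = 0` and `u = 0`. -/

/-- For multilinear maps, precomposition is continuous multilinear in `g` and linear in `f`, hence
smooth. A linear left inverse `B` of the inclusion of alternating into multilinear maps brings the
result back; it is continuous because `E` is finite-dimensional. -/
theorem ContDiffWithinAt.alternatingMap_compContinuousLinearMap {k : ℕ} {n : WithTop ℕ∞}
    {D E F : Type*}
    [NormedAddCommGroup D] [NormedSpace ℝ D]
    [NormedAddCommGroup E] [NormedSpace ℝ E] [FiniteDimensional ℝ E]
    [NormedAddCommGroup F] [NormedSpace ℝ F]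
    {f : D → F [⋀^Fin k]→L[ℝ] ℝ} {g : D → E →L[ℝ] F} {s : Set D} {x : D}
    (hf : ContDiffWithinAt ℝ n f s x) (hg : ContDiffWithinAt ℝ n g s x) :
    ContDiffWithinAt ℝ n (fun y => (f y).compContinuousLinearMap (g y)) s x := by
  let A : (E [⋀^Fin k]→L[ℝ] ℝ) →ₗ[ℝ] ContinuousMultilinearMap ℝ (fun _ : Fin k => E) ℝ :=
    (ContinuousAlternatingMap.toContinuousMultilinearMapCLM ℝ :
      (E [⋀^Fin k]→L[ℝ] ℝ) →L[ℝ] _).toLinearMap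
  have hA : LinearMap.ker A = ⊥ := LinearMap.ker_eq_bot.2
    ContinuousAlternatingMap.toContinuousMultilinearMap_injective
  obtain ⟨B, hB⟩ := A.exists_leftInverse_of_injective hA
  have : FiniteDimensional ℝ (ContinuousMultilinearMap ℝ (fun _ : Fin k => E) ℝ) :=
    Module.Finite.of_injective
      (ContinuousMultilinearMap.toMultilinearMapLinear :
        ContinuousMultilinearMap ℝ (fun _ : Fin k => E) ℝ →ₗ[ℝ] _) ContinuousMultilinearMap.toMultilinearMap_injective
  let C : ContinuousMultilinearMap ℝ (fun _ : Fin k => E →L[ℝ] F)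
      (ContinuousMultilinearMap ℝ (fun _ : Fin k => F) ℝ →L[ℝ]
        ContinuousMultilinearMap ℝ (fun _ : Fin k => E) ℝ) :=
    ContinuousMultilinearMap.compContinuousLinearMapContinuousMultilinear ℝ
      (fun _ : Fin k => E) (fun _ => F) ℝ
  have hCs : ContDiff ℝ n C := ContinuousMultilinearMap.contDiff (𝕜 := ℝ) (ι := Fin k)
    (E := fun _ => E →L[ℝ] F)
    (F := ContinuousMultilinearMap ℝ (fun _ : Fin k => F) ℝ →L[ℝ]
        ContinuousMultilinearMap ℝ (fun _ : Fin k => E) ℝ) C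
  have hC : ContDiffWithinAt ℝ n (fun y => C fun _ => g y) s x :=
    ContDiffAt.comp_contDiffWithinAt (f := fun (y : D) (_ : Fin k) => g y) (g := C) x
      hCs.contDiffAt (contDiffWithinAt_pi.2 fun _ => hg)
  have hf' : ContDiffWithinAt ℝ n (fun y => (f y).toContinuousMultilinearMap) s x :=
    (ContinuousAlternatingMap.toContinuousMultilinearMapCLM ℝ :
      (F [⋀^Fin k]→L[ℝ] ℝ) →L[ℝ] _).contDiff.contDiffAt.comp_contDiffWithinAt x hf
  have h := (LinearMap.toContinuousLinearMap B).contDiff.contDiffAt.comp_contDiffWithinAt x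
    (hC.clm_apply hf')
  refine h.congr_of_eventuallyEq (.of_forall fun y => ?_) ?_ <;>
  exact (LinearMap.congr_fun hB _).symm

theorem DiffForm.pullback_congr {n n' k : ℕ} {M N : Type*}
    [TopologicalSpace M] [ChartedSpace (EuclideanSpace ℝ (Fin n)) M]
    [TopologicalSpace N] [ChartedSpace (EuclideanSpace ℝ (Fin n')) N]
    (θ : DiffForm n' k N) {f g : M → N} {x : M} (h : f =ᶠ[nhds x] g) :
    θ.pullback (n := n) f x = θ.pullback (n := n) g x := by
  have hx : f x = g x := h.eq_of_nhds
  have hd : ∀ v : EuclideanSpace ℝ (Fin n), (mfderiv (𝓡 n) (𝓡 n') f x v :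
      EuclideanSpace ℝ (Fin n')) = mfderiv (𝓡 n) (𝓡 n') g x v := fun v => by
    rw [h.mfderiv_eq]
    rfl
  -- `θ (f x)` and `θ (g x)` have types over different base points; they become comparable on the
  -- common model space.
  have aux : ∀ (p q : N) (_ : p = q) (v w : Fin k → EuclideanSpace ℝ (Fin n')), v = w →
      (θ p : EuclideanSpace ℝ (Fin n') [⋀^Fin k]→L[ℝ] ℝ) v =
        (θ q : EuclideanSpace ℝ (Fin n') [⋀^Fin k]→L[ℝ] ℝ) w := by
    rintro p q rfl v w rfl; rfl
  exact ContinuousAlternatingMap.ext fun v => aux _ _ hx _ _ (funext fun i => hd (v i))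

theorem DiffForm.pullback_comp {n n' n'' k : ℕ} {M N P : Type*}
    [TopologicalSpace M] [ChartedSpace (EuclideanSpace ℝ (Fin n)) M]
    [TopologicalSpace N] [ChartedSpace (EuclideanSpace ℝ (Fin n')) N]
    [TopologicalSpace P] [ChartedSpace (EuclideanSpace ℝ (Fin n'')) P]
    (θ : DiffForm n'' k P) {f : M → N} {g : N → P} {x : M}
    (hg : MDifferentiableAt (𝓡 n') (𝓡 n'') g (f x))
    (hf : MDifferentiableAt (𝓡 n) (𝓡 n') f x) :
    θ.pullback (n := n) (g ∘ f) x = (θ.pullback (n := n') g).pullback (n := n) f x := by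
  refine ContinuousAlternatingMap.ext fun v => ?_
  simp only [DiffForm.pullback, mfderiv_comp x hg hf]
  rfl

/-- In charts, the pullback of a form along `f` is the pullback along the expression of `f`. -/
theorem DiffForm.inChart_pullback {n n' k : ℕ} {M N : Type*}
    [TopologicalSpace M] [ChartedSpace (EuclideanSpace ℝ (Fin n)) M]
    [TopologicalSpace N] [ChartedSpace (EuclideanSpace ℝ (Fin n')) N]
    [IsManifold (𝓡 n) ∞ M] [IsManifold (𝓡 n') ∞ N]
    (θ : DiffForm n' k N) {f : M → N} (hf : ContMDiff (𝓡 n) (𝓡 n') ∞ f)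
    {e : OpenPartialHomeomorph M (EuclideanSpace ℝ (Fin n))}
    (he : e ∈ IsManifold.maximalAtlas (𝓡 n) ∞ M)
    {e' : OpenPartialHomeomorph N (EuclideanSpace ℝ (Fin n'))}
    (he' : e' ∈ IsManifold.maximalAtlas (𝓡 n') ∞ N)
    {u : EuclideanSpace ℝ (Fin n)} (hu : u ∈ e.target) (hfu : f (e.symm u) ∈ e'.source) :
    (θ.pullback (n := n) f).inChart e u =
      (θ.inChart e' ((e' ∘ f ∘ e.symm) u)).compContinuousLinearMap
        (fderiv ℝ (e' ∘ f ∘ e.symm) u) := by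
  have hes := (contMDiffAt_symm_of_mem_maximalAtlas he hu).mdifferentiableAt (by simp)
  have hfd := (hf (e.symm u)).mdifferentiableAt (by simp)
  have hfe : MDifferentiableAt (𝓡 n) (𝓡 n') (f ∘ e.symm) u := hfd.comp u hes
  have he'd := (contMDiffAt_of_mem_maximalAtlas he' hfu).mdifferentiableAt (by simp)
  have hgd : MDifferentiableAt (𝓡 n) (𝓡 n') (e' ∘ f ∘ e.symm) u := he'd.comp u hfe
  have he's := (contMDiffAt_symm_of_mem_maximalAtlas he' (e'.map_source hfu)).mdifferentiableAt
    (by simp)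
  -- This factorization through `e'` holds only near `u`, which suffices because a pullback at `u`
  -- depends only on the germ of the map.
  have hev : f ∘ e.symm =ᶠ[nhds u] e'.symm ∘ (e' ∘ f ∘ e.symm) := by
    filter_upwards [hfe.continuousAt.preimage_mem_nhds (e'.open_source.mem_nhds hfu)] with y hy
    exact (e'.left_inv hy).symm
  have h := ((θ.pullback_comp hfd hes).symm.trans (θ.pullback_congr hev)).trans
    (θ.pullback_comp (g := e'.symm) he's hgd)
  rw [← mfderiv_eq_fderiv]
  exact h

theorem contDiffAt_writtenInCharts {n n' : ℕ} {M N : Type*}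
    [TopologicalSpace M] [ChartedSpace (EuclideanSpace ℝ (Fin n)) M]
    [TopologicalSpace N] [ChartedSpace (EuclideanSpace ℝ (Fin n')) N]
    [IsManifold (𝓡 n) ∞ M] [IsManifold (𝓡 n') ∞ N]
    {f : M → N} (hf : ContMDiff (𝓡 n) (𝓡 n') ∞ f)
    {e : OpenPartialHomeomorph M (EuclideanSpace ℝ (Fin n))}
    (he : e ∈ IsManifold.maximalAtlas (𝓡 n) ∞ M)
    {e' : OpenPartialHomeomorph N (EuclideanSpace ℝ (Fin n'))}
    (he' : e' ∈ IsManifold.maximalAtlas (𝓡 n') ∞ N)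
    {u : EuclideanSpace ℝ (Fin n)} (hu : u ∈ e.target) (hfu : f (e.symm u) ∈ e'.source) :
    ContDiffAt ℝ ∞ (e' ∘ f ∘ e.symm) u :=
  ContMDiffAt.contDiffAt <| (contMDiffAt_of_mem_maximalAtlas he' hfu).comp u
    ((hf (e.symm u)).comp u (contMDiffAt_symm_of_mem_maximalAtlas he hu))

theorem DiffForm.inChart_pullback_eventuallyEq {n n' k : ℕ} {M N : Type*}
    [TopologicalSpace M] [ChartedSpace (EuclideanSpace ℝ (Fin n)) M]
    [TopologicalSpace N] [ChartedSpace (EuclideanSpace ℝ (Fin n')) N]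
    [IsManifold (𝓡 n) ∞ M] [IsManifold (𝓡 n') ∞ N]
    (θ : DiffForm n' k N) {f : M → N} (hf : ContMDiff (𝓡 n) (𝓡 n') ∞ f)
    {e : OpenPartialHomeomorph M (EuclideanSpace ℝ (Fin n))}
    (he : e ∈ IsManifold.maximalAtlas (𝓡 n) ∞ M)
    {e' : OpenPartialHomeomorph N (EuclideanSpace ℝ (Fin n'))}
    (he' : e' ∈ IsManifold.maximalAtlas (𝓡 n') ∞ N)
    {u : EuclideanSpace ℝ (Fin n)} (hu : u ∈ e.target) (hfu : f (e.symm u) ∈ e'.source) :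
    (θ.pullback (n := n) f).inChart e =ᶠ[nhds u] fun y =>
      (θ.inChart e' ((e' ∘ f ∘ e.symm) y)).compContinuousLinearMap
        (fderiv ℝ (e' ∘ f ∘ e.symm) y) := by
  filter_upwards [e.open_target.mem_nhds hu,
    (hf.continuous.continuousAt.comp (e.continuousAt_symm hu)).preimage_mem_nhds
      (e'.open_source.mem_nhds hfu)] with y hy hfy
  exact θ.inChart_pullback hf he he' hy hfy

theorem DiffForm.IsSmooth.pullback {n n' k : ℕ} {M N : Type*}
    [TopologicalSpace M] [ChartedSpace (EuclideanSpace ℝ (Fin n)) M]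
    [TopologicalSpace N] [ChartedSpace (EuclideanSpace ℝ (Fin n')) N]
    [IsManifold (𝓡 n) ∞ M] [IsManifold (𝓡 n') ∞ N]
    {θ : DiffForm n' k N} (hθ : θ.IsSmooth) {f : M → N} (hf : ContMDiff (𝓡 n) (𝓡 n') ∞ f) :
    (θ.pullback (n := n) f).IsSmooth := by
  intro e he u hu
  have hfu := mem_chart_source (EuclideanSpace ℝ (Fin n')) (f (e.symm u))
  have he' := IsManifold.chart_mem_maximalAtlas (I := 𝓡 n') (n := ∞) (f (e.symm u))
  have hg := contDiffAt_writtenInCharts hf he he' hu hfu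
  have hθg := ((hθ _ he').contDiffAt ((chartAt _ _).open_target.mem_nhds
    ((chartAt _ _).map_source hfu))).comp u hg
  have h := ContDiffWithinAt.alternatingMap_compContinuousLinearMap (s := Set.univ)
    hθg.contDiffWithinAt (hg.fderiv_right (m := ∞) (by simp)).contDiffWithinAt
  exact (h.contDiffAt Filter.univ_mem |>.congr_of_eventuallyEq
    (θ.inChart_pullback_eventuallyEq hf he he' hu hfu)).contDiffWithinAt

theorem DiffForm.IsClosed.pullback {n n' k : ℕ} {M N : Type*}
    [TopologicalSpace M] [ChartedSpace (EuclideanSpace ℝ (Fin n)) M]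
    [TopologicalSpace N] [ChartedSpace (EuclideanSpace ℝ (Fin n')) N]
    [IsManifold (𝓡 n) ∞ M] [IsManifold (𝓡 n') ∞ N]
    {θ : DiffForm n' k N} (hc : θ.IsClosed) (hθ : θ.IsSmooth) {f : M → N}
    (hf : ContMDiff (𝓡 n) (𝓡 n') ∞ f) :
    (θ.pullback (n := n) f).IsClosed := by
  intro e he u hu
  have hfu := mem_chart_source (EuclideanSpace ℝ (Fin n')) (f (e.symm u))
  have he' := IsManifold.chart_mem_maximalAtlas (I := 𝓡 n') (n := ∞) (f (e.symm u))
  have hg := contDiffAt_writtenInCharts hf he he' hu hfu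
  have ht := (chartAt (EuclideanSpace ℝ (Fin n')) (f (e.symm u))).map_source hfu
  have hθd := ((hθ _ he').contDiffAt ((chartAt _ _).open_target.mem_nhds ht)).differentiableAt
    (by simp)
  -- The side goal of `extDeriv_pullback` asks for enough derivatives of the map, which `∞`
  -- provides.
  rw [(θ.inChart_pullback_eventuallyEq hf he he' hu hfu).extDeriv_eq,
    extDeriv_pullback (f := chartAt (EuclideanSpace ℝ (Fin n')) (f (e.symm u)) ∘ f ∘ e.symm)
      hθd hg (by simpa using ENat.LEInfty.out)]
  have h0 := hc _ he' _ ht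
  simp only [Function.comp_apply, h0]
  rfl

/-- In adapted charts `f` is the injective linear map `L : v ↦ h.equiv (v, 0)`. The chain rule makes
`d(codChart) ∘ df` equal to `L ∘ d(domChart)`, which is injective, so `df` is too. -/
theorem Manifold.IsImmersion.mfderiv_injective {n n' : ℕ} {M N : Type*}
    [TopologicalSpace M] [ChartedSpace (EuclideanSpace ℝ (Fin n)) M]
    [TopologicalSpace N] [ChartedSpace (EuclideanSpace ℝ (Fin n')) N]
    [IsManifold (𝓡 n) ∞ M] [IsManifold (𝓡 n') ∞ N]
    {f : M → N} (hf : Manifold.IsImmersion (𝓡 n) (𝓡 n') ∞ f) (x : M) :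
    Function.Injective (mfderiv (𝓡 n) (𝓡 n') f x) := by
  have h := hf.isImmersionAt x
  have hx := h.mem_domChart_source
  have hfx := h.mem_codChart_source
  have hfd := (hf.contMDiff x).mdifferentiableAt (by simp)
  have hd := (contMDiffAt_of_mem_maximalAtlas h.domChart_mem_maximalAtlas hx).mdifferentiableAt
    (by simp)
  have hc := (contMDiffAt_of_mem_maximalAtlas h.codChart_mem_maximalAtlas hfx).mdifferentiableAt
    (by simp)
  let L := h.equiv.toContinuousLinearMap.comp
    (ContinuousLinearMap.inl ℝ (EuclideanSpace ℝ (Fin n)) h.complement)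
  have hL : Function.Injective L := h.equiv.injective.comp (Prod.mk_left_injective 0)
  have hev : h.codChart ∘ f =ᶠ[nhds x] L ∘ h.domChart := by
    filter_upwards [h.domChart.open_source.mem_nhds hx] with y hy
    have hyt : h.domChart y ∈ (h.domChart.extend (𝓡 n)).target := by
      simpa using h.domChart.map_source hy
    simpa [h.domChart.left_inv hy, L] using h.writtenInCharts hyt
  have hLd : MDifferentiableAt (𝓡 n) (𝓡 n') L (h.domChart x) :=
    L.differentiableAt.mdifferentiableAt
  have heq := hev.mfderiv_eq (I := 𝓡 n) (I' := 𝓡 n')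
  rw [mfderiv_comp x hc hfd, mfderiv_comp x hLd hd] at heq
  have hdm : h.domChart.MDifferentiable (𝓡 n) (𝓡 n) :=
    ⟨(contMDiffOn_of_mem_maximalAtlas h.domChart_mem_maximalAtlas).mdifferentiableOn (by simp),
      (contMDiffOn_symm_of_mem_maximalAtlas h.domChart_mem_maximalAtlas).mdifferentiableOn
        (by simp)⟩
  have hLi : Function.Injective (mfderiv (𝓡 n) (𝓡 n') L (h.domChart x)) := by
    rw [mfderiv_eq_fderiv, L.fderiv]
    exact hL
  have hinj := hLi.comp (hdm.mfderiv_injective hx)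
  have hcomp : Function.Injective
      ((mfderiv (𝓡 n') (𝓡 n') h.codChart (f x)).comp (mfderiv (𝓡 n) (𝓡 n') f x)) := by
    rw [heq]
    exact hinj
  exact Function.Injective.of_comp hcomp

theorem ContinuousAlternatingMap.eq_zero_of_orthogonal_range {E V : Type*}
    [NormedAddCommGroup E] [NormedSpace ℝ E] [FiniteDimensional ℝ E]
    [AddCommGroup V] [Module ℝ V] [FiniteDimensional ℝ V]
    (b : E [⋀^Fin 2]→L[ℝ] ℝ) (hb : ∀ a : E, (∀ v : E, b ![a, v] = 0) → a = 0)
    (D : V →ₗ[ℝ] E) (hD : Function.Injective D)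
    (hdim : Module.finrank ℝ E = Module.finrank ℝ V + 2)
    {w : E} (hw : w ∉ Set.range D) (hwD : ∀ v, b ![w, D v] = 0)
    {a : V} (ha : ∀ v, b ![D a, D v] = 0) : a = 0 := by
  have hu : ∀ a v w : E, Function.update ![a, v] 1 w = ![a, w] := fun a v w => by
    ext i : 1
    fin_cases i <;> simp
  let F : E →ₗ[ℝ] Module.Dual ℝ E := LinearMap.mk₂ ℝ (fun a v => b ![a, v])
    (fun a a' v => by simpa using b.toMultilinearMap.cons_add ![v] a a')
    (fun c a v => by simpa using b.toMultilinearMap.cons_smul ![v] c a)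
    (fun a v v' => by
      have := b.map_update_add ![a, v] 1 v v'
      rwa [hu, hu, hu] at this)
    (fun c a v => by
      have := b.map_update_smul ![a, v] 1 c v
      rwa [hu, hu] at this)
  have hFinj : Function.Injective F :=
    (injective_iff_map_eq_zero F).2 fun a ha => hb a fun v => LinearMap.congr_fun ha v
  have hself : ∀ z : E, b ![z, z] = 0 := fun z =>
    b.map_eq_zero_of_eq ![z, z] (i := 0) (j := 1) rfl (by decide)
  -- Polarization: expand `b(D a + w, D a + w) = 0`.
  have hswap : b ![D a, w] = 0 := by
    have h := hself (D a + w)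
    have h' : F (D a + w) (D a + w) = 0 := h
    have h1 : F (D a) (D a) = 0 := hself _
    have h2 : F w w = 0 := hself _
    have h3 : F w (D a) = 0 := hwD a
    simp only [map_add, LinearMap.add_apply, h1, h2, h3] at h'
    rw [zero_add, zero_add, add_zero] at h'
    exact h'
  let S : Submodule ℝ E := LinearMap.range D ⊔ Submodule.span ℝ {w}
  have hwS : w ∉ LinearMap.range D := hw
  have hw0 : w ≠ 0 := fun h => hwS (h ▸ zero_mem _)
  have hS : Module.finrank ℝ S = Module.finrank ℝ V + 1 := by
    have hdisj : LinearMap.range D ⊓ Submodule.span ℝ {w} = ⊥ :=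
      disjoint_iff.1 ((Submodule.disjoint_span_singleton' hw0).2 hwS)
    have h := Submodule.finrank_sup_add_finrank_inf_eq (LinearMap.range D) (Submodule.span ℝ {w})
    rw [hdisj, finrank_bot, finrank_span_singleton hw0, LinearMap.finrank_range_of_inj hD] at h
    exact h
  have hann : Module.finrank ℝ S.dualAnnihilator = 1 := by
    have := Subspace.finrank_add_finrank_dualAnnihilator_eq S
    omega
  have hmem : ∀ z : E, (∀ v, F z (D v) = 0) → F z w = 0 → F z ∈ S.dualAnnihilator := by
    intro z h1 h2
    rw [Submodule.mem_dualAnnihilator]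
    intro s hs
    obtain ⟨_, ⟨v, rfl⟩, _, hy, rfl⟩ := Submodule.mem_sup.1 hs
    obtain ⟨c, rfl⟩ := Submodule.mem_span_singleton.1 hy
    simp [h1, h2]
  have hFw := hmem w hwD (hself w)
  have hFa := hmem (D a) ha hswap
  -- `F w` is nonzero, hence spans the line `S.dualAnnihilator`, which also contains `F (D a)`.
  obtain ⟨c, hc⟩ := exists_smul_eq_of_finrank_eq_one (V := S.dualAnnihilator) hann
    (x := ⟨F w, hFw⟩) (fun h => hw0 (hFinj (by simpa using congrArg Subtype.val h)))
    ⟨F (D a), hFa⟩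
  have hca : c • w = D a := hFinj (by simpa using congrArg Subtype.val hc)
  have hc0 : c = 0 := by
    by_contra h
    exact hw ⟨c⁻¹ • a, by rw [map_smul, ← hca, inv_smul_smul₀ h]⟩
  exact hD (by rw [LinearMap.map_zero, ← hca, hc0, zero_smul])

theorem hamiltonianVectorField_spec {n : ℕ} {M : Type*}
    [TopologicalSpace M] [ChartedSpace (EuclideanSpace ℝ (Fin n)) M]
    {β : DiffForm n 2 M} (hβ : IsSymplectic β) (H : M → ℝ) (x : M) (v : TangentSpace (𝓡 n) x) :
    β x ![hamiltonianVectorField hβ H x, v] = -(mfderiv (𝓡 n) 𝓘(ℝ, ℝ) H x v : ℝ) :=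
  (hβ.nondegenerate.existsUnique x (-(mfderiv (𝓡 n) 𝓘(ℝ, ℝ) H x))).choose_spec.1 v

/-- Chain rule for the constant function `H ∘ f`. -/
theorem mfderiv_apply_mfderiv_eq_zero {n n' : ℕ} {M N : Type*}
    [TopologicalSpace M] [ChartedSpace (EuclideanSpace ℝ (Fin n)) M]
    [TopologicalSpace N] [ChartedSpace (EuclideanSpace ℝ (Fin n')) N]
    {H : N → ℝ} {f : M → N} {h : ℝ} {y : M}
    (hH : MDifferentiableAt (𝓡 n') 𝓘(ℝ, ℝ) H (f y))
    (hf : MDifferentiableAt (𝓡 n) (𝓡 n') f y) (hfh : ∀ y, f y ∈ energyLevel H h)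
    (v : TangentSpace (𝓡 n) y) :
    (mfderiv (𝓡 n') 𝓘(ℝ, ℝ) H (f y) (mfderiv (𝓡 n) (𝓡 n') f y v) : ℝ) = 0 := by
  have hconst : H ∘ f = fun _ => h := funext hfh
  have hcomp := mfderiv_comp y hH hf
  rw [hconst, mfderiv_const] at hcomp
  exact (DFunLike.congr_fun hcomp v).symm

theorem mainTheorem11 {m : ℕ} (hm : 1 ≤ m)
    {N : Type*} [TopologicalSpace N] [ChartedSpace (EuclideanSpace ℝ (Fin (2 * m))) N]
    [IsManifold (𝓡 (2 * m)) ∞ N]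
    (β : DiffForm (2 * m) 2 N) (hβ : IsSymplectic β)
    (H : N → ℝ) (hH : ContMDiff (𝓡 (2 * m)) 𝓘(ℝ, ℝ) 1 H) (h : ℝ)
    (hE : ∀ z ∈ energyLevel H h, mfderiv (𝓡 (2 * m)) 𝓘(ℝ, ℝ) H z ≠ 0)
    {Y : Type*} [TopologicalSpace Y] [ChartedSpace (EuclideanSpace ℝ (Fin (2 * m - 2))) Y]
    [IsManifold (𝓡 (2 * m - 2)) ∞ Y]
    (ι : Y → N) (hι : Manifold.IsImmersion (𝓡 (2 * m - 2)) (𝓡 (2 * m)) ∞ ι)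
    (hYE : ∀ y, ι y ∈ energyLevel H h)
    (hw : ∀ y, hamiltonianVectorField hβ H (ι y) ∉
      Set.range (mfderiv (𝓡 (2 * m - 2)) (𝓡 (2 * m)) ι y)) :
    IsSymplectic (β.pullback (n := 2 * m - 2) ι) where
  smooth := hβ.smooth.pullback hι.contMDiff
  closed := hβ.closed.pullback hβ.smooth hι.contMDiff
  nondegenerate y a ha := by
    let D : EuclideanSpace ℝ (Fin (2 * m - 2)) →L[ℝ] EuclideanSpace ℝ (Fin (2 * m)) :=
      mfderiv (𝓡 (2 * m - 2)) (𝓡 (2 * m)) ι y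
    have hpair : ∀ v w : EuclideanSpace ℝ (Fin (2 * m - 2)), D ∘ ![v, w] = ![D v, D w] :=
      fun v w => by ext i : 1; fin_cases i <;> rfl
    refine ContinuousAlternatingMap.eq_zero_of_orthogonal_range
      (E := EuclideanSpace ℝ (Fin (2 * m))) (V := EuclideanSpace ℝ (Fin (2 * m - 2)))
      (β (ι y)) (hβ.nondegenerate (ι y)) D.toLinearMap (hι.mfderiv_injective y)
      -- `hm` is needed here: without it the subtraction in `2 * m - 2` could truncate.
      (by simp only [finrank_euclideanSpace_fin]; omega)
      (w := hamiltonianVectorField hβ H (ι y)) (hw y) (fun v => ?_) (fun v => ?_)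
    · refine (hamiltonianVectorField_spec hβ H (ι y) (D v)).trans (neg_eq_zero.2 ?_)
      exact mfderiv_apply_mfderiv_eq_zero ((hH (ι y)).mdifferentiableAt one_ne_zero)
        ((hι.contMDiff y).mdifferentiableAt (by simp)) hYE v
    · have h := ha v
      exact (congrArg (β (ι y) : EuclideanSpace ℝ (Fin (2 * m)) [⋀^Fin 2]→L[ℝ] ℝ)
        (hpair a v)).symm.trans h
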